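/- All algebras are unital. For a complex normed algebra $A$ (with submultiplicative norm) let $\bar A$ be its completion. $A$ is called a \emph{local Banach algebra} if for every natural number $k$ the matrix algebra $M_k(A)$ is closed under the holomorphic functional calculus of $M_k(\bar A)$: whenever $x\in M_k(A)$ and $h$ is holomorphic on an open neighbourhood of the spectrum of $x$ in $M_k(\bar A)$, then $h(x)\in M_k(A)$. For an integer $n\ge 2$, an element $e$ of $A$ is an \emph{$n$-potent} if $e^n=e$. For $e,f\in A$ put $$v_n(e,f)=e^{n-1}f^{n-1}+(n-1)(1-e^{n-1})(1-f^{n-1})+\sum_{k=1}^{n-2}e^kf^{(n-1)-k},$$ where the sum is empty if $n=2$. \textbf{Theorem.} Let $n\ge 2$, let $e$ and $f$ be $n$-potents in a local Banach algebra $A$, and set $M=(1+\|e\|)^{2n}$. Suppose that $$\|e-f\|<\frac{2(n-1)}{(n^2+n+2)M}.$$ Then $M\ge 1$, the bound on the right-hand side is less than $1$, and there is an invertible $z\in A$ with $\|z-1\|<1$ and $zez^{-1}=f$; in particular $e$ and $f$ are similar. Explicitly, one may take $z=v_n(f,e)/(n-1)$. Moreover, $w=v_n(e,f)/(n-1)$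 is also invertible, with $\|w-1\|<1$ and $w^{-1}ew=f$. -/

import Mathlib

/-- An `n`-potent of a ring (used for `n ≥ 2`): an element `e` with `e ^ n = e`. -/
def IsNPotent {R : Type*} [Ring R] (n : ℕ) (e : R) : Prop :=
  e ^ n = e

/-- A contour in the complex plane: a finite family of closed `C¹` curves, each of them
parametrised by `[0, 1]`. (A closed piecewise `C¹` curve can be reparametrised as such a curve,
since the derivative is allowed to vanish.) -/
structure Contour where
  /-- the number of closed curves -/
  size : ℕ
  /-- the closed curves -/
  curve : Fin size → ℝ → ℂ
  contDiffOn_curve : ∀ i, ContDiffOn ℝ 1 (curve i) (Set.Icc 0 1)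
  closed_curve : ∀ i, curve i 0 = curve i 1

namespace Contour

/-- The set of the points on the curves of the contour. -/
def trace (Γ : Contour) : Set ℂ :=
  ⋃ i, Γ.curve i '' Set.Icc 0 1

/-- The contour integral `∮_Γ F(z) dz` of a function with values in a complex normed space. -/
noncomputable def integral {E : Type*} [NormedAddCommGroup E] [NormedSpace ℂ E]
    (Γ : Contour) (F : ℂ → E) : E :=
  ∑ i, ∫ t in (0 : ℝ)..1, deriv (Γ.curve i) t • F (Γ.curve i t)

/-- The winding number `(2πi)⁻¹ ∮_Γ (z - w)⁻¹ dz` of the contour about a point `w` off it. -/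
noncomputable def windingNumber (Γ : Contour) (w : ℂ) : ℂ :=
  (2 * (Real.pi : ℂ) * Complex.I)⁻¹ * Γ.integral (fun z => (z - w)⁻¹)

/-- The contour lies in `U \ K`, winds once about each point of `K`, and does not wind about any
point outside `U`. -/
def Surrounds (Γ : Contour) (K U : Set ℂ) : Prop :=
  Γ.trace ⊆ U \ K ∧ (∀ w ∈ K, Γ.windingNumber w = 1) ∧ (∀ w ∉ U, Γ.windingNumber w = 0)

end Contour

/-- The holomorphic functional calculus `f(x) = (2πi)⁻¹ ∮_Γ f(z) (z - x)⁻¹ dz` in the matrix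
algebra `M_k(B)` over a complex Banach algebra `B`, for a contour `Γ` that surrounds the spectrum
of `x` inside the domain of `f`. The integral is taken entry by entry. -/
noncomputable def holomorphicFunctionalCalculus {B : Type*} [NormedRing B] [NormedAlgebra ℂ B]
    {k : ℕ} (Γ : Contour) (f : ℂ → ℂ) (x : Matrix (Fin k) (Fin k) B) : Matrix (Fin k) (Fin k) B :=
  Matrix.of fun i j =>
    (2 * (Real.pi : ℂ) * Complex.I)⁻¹ • Γ.integral (fun z => f z • resolvent x z i j)

/-- The completion of a complex normed algebra, commutative or not, is a complex normed algebra. -/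
noncomputable instance completionNormedAlgebra (A : Type*) [NormedRing A] [NormedAlgebra ℂ A] :
    NormedAlgebra ℂ (UniformSpace.Completion A) where
  __ := UniformSpace.Completion.algebra A ℂ
  norm_smul_le := norm_smul_le

/-- A unital complex normed algebra `A` is a local Banach algebra if, for each `k`, the matrix
algebra `M_k(A)` is closed under the holomorphic functional calculus of `M_k(B)`, where `B` is the
completion of `A`: for every `x` in `M_k(A)` and every function `f` that is holomorphic on an open
neighbourhood `U` of the spectrum of `x` in `M_k(B)`, the element `f(x)` lies in `M_k(A)`. -/
class IsLocalBanachAlgebra (A : Type*) [NormedRing A] [NormedAlgebra ℂ A] : Prop where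
  closed_functionalCalculus : ∀ (k : ℕ) (x : Matrix (Fin k) (Fin k) A)
    (xhat : Matrix (Fin k) (Fin k) (UniformSpace.Completion A)),
    xhat = x.map (fun a => (a : UniformSpace.Completion A)) →
    ∀ (U : Set ℂ) (f : ℂ → ℂ), IsOpen U → spectrum ℂ xhat ⊆ U → DifferentiableOn ℂ f U →
    ∀ Γ : Contour, Γ.Surrounds (spectrum ℂ xhat) U →
    ∃ y : Matrix (Fin k) (Fin k) A,
      y.map (fun a => (a : UniformSpace.Completion A)) = holomorphicFunctionalCalculus Γ f xhat

/-- The element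
`e^(n-1) f^(n-1) + (n-1) (1 - e^(n-1)) (1 - f^(n-1)) + ∑_{k=1}^{n-2} e^k f^(n-1-k)`
(for `n = 2` the sum is empty). -/
noncomputable def nPotentIntertwiner {A : Type*} [Ring A] [Algebra ℂ A] (n : ℕ) (e f : A) : A :=
  e ^ (n - 1) * f ^ (n - 1) + ((n : ℂ) - 1) • ((1 - e ^ (n - 1)) * (1 - f ^ (n - 1)))
    + ∑ k ∈ Finset.Icc 1 (n - 2), e ^ k * f ^ (n - 1 - k)

/-! Multiplying `v = v_n(e,f)` by `e` on the left or by `f` on the right gives the same element, so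
`e v = v f`. Since `e^(n-1)` is idempotent, `v_n(e,e) = n-1`; hence `v/(n-1)` is near `1` when `f`
is near `e`, and it conjugates `e` to `f` once it is invertible (`mul_nPotentIntertwiner`,
`norm_nPotentIntertwiner_sub_le`). As `A` need not be complete, the Neumann series inverts only in
the completion. The functional calculus for `1/z` on the unit disc about `1`, in the case `k = 1`,
brings the inverse back into `A` (`isUnit_of_norm_sub_one_lt`). -/

/-! ### Norm estimates for powers. -/

/-- The factor `x` keeps the case `j = 0` true: `‖1‖ ≤ 1` is not assumed. -/
theorem norm_mul_pow_le_of_norm_le {A : Type*} [NormedRing A] {q : A} {s : ℝ} (hs : 0 ≤ s)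
    (hq : ‖q‖ ≤ s) (x : A) (j : ℕ) : ‖x * q ^ j‖ ≤ ‖x‖ * s ^ j := by
  induction j with
  | zero => simp
  | succ j ih =>
    rw [pow_succ, ← mul_assoc, pow_succ, ← mul_assoc]
    exact (norm_mul_le _ _).trans (mul_le_mul ih hq (norm_nonneg _) (by positivity))

theorem norm_pow_mul_le_of_norm_le {A : Type*} [NormedRing A] {q : A} {s : ℝ} (hs : 0 ≤ s)
    (hq : ‖q‖ ≤ s) (x : A) (j : ℕ) : ‖q ^ j * x‖ ≤ s ^ j * ‖x‖ := by
  induction j with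
  | zero => simp
  | succ j ih =>
    rw [pow_succ', mul_assoc, pow_succ', mul_assoc]
    exact (norm_mul_le _ _).trans (mul_le_mul hq ih (norm_nonneg _) hs)

theorem norm_pow_sub_pow_le {A : Type*} [NormedRing A] {p q : A}
    (hp : ‖p‖ ≤ 1 + ‖q‖) (j : ℕ) :
    ‖p ^ j - q ^ j‖ ≤ (1 + ‖q‖) ^ j * ‖p - q‖ := by
  -- Subtracting `‖q‖ ^ j` makes the induction close exactly, with no factor `j`.
  have key : ‖p ^ j - q ^ j‖ ≤ ((1 + ‖q‖) ^ j - ‖q‖ ^ j) * ‖p - q‖ := by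
    induction j with
    | zero => simp
    | succ j ih =>
      have h : p ^ (j + 1) - q ^ (j + 1) = p * (p ^ j - q ^ j) + (p - q) * q ^ j := by
        rw [pow_succ', pow_succ']; noncomm_ring
      rw [h]
      calc _ ≤ ‖p * (p ^ j - q ^ j)‖ + ‖(p - q) * q ^ j‖ := norm_add_le _ _
        _ ≤ (1 + ‖q‖) * (((1 + ‖q‖) ^ j - ‖q‖ ^ j) * ‖p - q‖) + ‖p - q‖ * ‖q‖ ^ j := by
          refine add_le_add ((norm_mul_le _ _).trans ?_)
            (norm_mul_pow_le_of_norm_le (norm_nonneg _) le_rfl _ _)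
          exact mul_le_mul hp ih (norm_nonneg _) (by positivity)
        _ = _ := by ring
  refine key.trans (mul_le_mul_of_nonneg_right ?_ (norm_nonneg _))
  have : 0 ≤ ‖q‖ ^ j := by positivity
  linarith

/-! ### Algebra of the intertwiner. -/

theorem IsNPotent.mul_pow_pred {R : Type*} [Ring R] {m : ℕ} {e : R} (he : IsNPotent (m + 1) e) :
    e * e ^ m = e := by
  rw [← pow_succ']; exact he

theorem IsNPotent.pow_pred_mul {R : Type*} [Ring R] {m : ℕ} {e : R} (he : IsNPotent (m + 1) e) :
    e ^ m * e = e := by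
  rw [← pow_succ]; exact he

theorem IsNPotent.pow_pred_mul_self {R : Type*} [Ring R] {m : ℕ} (hm : 1 ≤ m) {e : R}
    (he : IsNPotent (m + 1) e) : e ^ m * e ^ m = e ^ m := by
  obtain ⟨k, rfl⟩ := Nat.exists_eq_add_of_le' hm
  conv_lhs => rw [pow_succ e k, mul_assoc, ← pow_succ e k, he.mul_pow_pred]
  rw [pow_succ]

theorem mul_nPotentIntertwiner {A : Type*} [Ring A] [Algebra ℂ A] {n : ℕ} (hn : 2 ≤ n) {e f : A}
    (he : IsNPotent n e) (hf : IsNPotent n f) :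
    e * nPotentIntertwiner n e f = nPotentIntertwiner n e f * f := by
  obtain ⟨m, rfl⟩ := Nat.exists_eq_add_of_le' hn
  have hE : e * e ^ (m + 1) = e := IsNPotent.mul_pow_pred he
  have hF : f ^ (m + 1) * f = f := IsNPotent.pow_pred_mul hf
  have h1 : e * (1 - e ^ (m + 1)) = 0 := by rw [mul_sub, hE, mul_one, sub_self]
  have h2 : (1 - f ^ (m + 1)) * f = 0 := by rw [sub_mul, hF, one_mul, sub_self]
  have hsum : ∀ g : ℕ → A, ∑ k ∈ Finset.Icc 1 m, g k = ∑ k ∈ Finset.range m, g (k + 1) := by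
    intro g
    rw [Finset.range_eq_Ico, Finset.sum_Ico_add' g 0 m 1]
    rfl
  -- Both sides are `∑ k ≤ m, e^(k+1) f^(m+1-k)`, with the first or the last term split off.
  have key : e * f ^ (m + 1) + ∑ k ∈ Finset.range m, e ^ (k + 2) * f ^ (m - k)
      = e ^ (m + 1) * f + ∑ k ∈ Finset.range m, e ^ (k + 1) * f ^ (m + 1 - k) := by
    have a := Finset.sum_range_succ (fun k => e ^ (k + 1) * f ^ (m + 1 - k)) m
    rw [Finset.sum_range_succ'] at a
    simp only [Nat.add_sub_add_right, Nat.sub_zero, zero_add, pow_one, add_assoc,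
      Nat.add_sub_cancel_left] at a
    rw [add_comm, a, add_comm]
  simp only [nPotentIntertwiner, Nat.add_sub_cancel, show m + 2 - 1 = m + 1 from rfl, hsum]
  rw [mul_add, mul_add, add_mul, add_mul, mul_smul_comm, smul_mul_assoc, ← mul_assoc e (1 - _), h1,
    mul_assoc (1 - e ^ (m + 1)), h2, ← mul_assoc e, hE, mul_assoc _ _ f, hF, Finset.mul_sum,
    Finset.sum_mul]
  simp only [zero_mul, mul_zero, smul_zero, add_zero]
  refine Eq.trans ?_ (key.trans ?_)
  · congr 1
    refine Finset.sum_congr rfl fun k _ => ?_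
    rw [← mul_assoc, ← pow_succ', Nat.add_sub_add_right]
  · congr 1
    refine Finset.sum_congr rfl fun k hk => ?_
    have := Finset.mem_range.1 hk
    rw [mul_assoc, ← pow_succ]
    congr 2
    omega

/-- This is `v(e,f) - v(e,e)`, arranged so that every term has a factor `f^j - e^j`. -/
theorem nPotentIntertwiner_sub {A : Type*} [Ring A] [Algebra ℂ A] {m : ℕ} (hm : 1 ≤ m) {e f : A}
    (he : IsNPotent (m + 1) e) :
    nPotentIntertwiner (m + 1) e f - (m : ℂ) • (1 : A) =
      ((m : ℂ) + 1) • (e ^ m * (f ^ m - e ^ m)) - (m : ℂ) • (f ^ m - e ^ m)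
        + ∑ k ∈ Finset.Icc 1 (m - 1), e ^ k * (f ^ (m - k) - e ^ (m - k)) := by
  have hs : ∑ k ∈ Finset.Icc 1 (m - 1), e ^ k * (f ^ (m - k) - e ^ (m - k))
      = ∑ k ∈ Finset.Icc 1 (m - 1), e ^ k * f ^ (m - k) - ((m : ℂ) - 1) • e ^ m := by
    have : ∀ k ∈ Finset.Icc 1 (m - 1), e ^ k * (f ^ (m - k) - e ^ (m - k))
        = e ^ k * f ^ (m - k) - e ^ m := by
      intro k hk
      have := Finset.mem_Icc.1 hk
      rw [mul_sub, ← pow_add, show k + (m - k) = m by omega]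
    rw [Finset.sum_congr rfl this, Finset.sum_sub_distrib, Finset.sum_const, Nat.card_Icc,
      ← Nat.cast_smul_eq_nsmul ℂ, Nat.add_sub_cancel, Nat.cast_sub hm, Nat.cast_one]
  rw [hs]
  simp only [nPotentIntertwiner, Nat.add_sub_cancel, show m + 1 - 2 = m - 1 from rfl]
  push_cast
  simp only [mul_sub, sub_mul, he.pow_pred_mul_self hm, mul_one, one_mul]
  module

/-- The three terms of `nPotentIntertwiner_sub` contribute `(m+1) + m + (m-1) = 3m`. A common bound
`s`, not `‖e‖` itself, lets `e` and `f` be exchanged later. -/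
theorem norm_nPotentIntertwiner_sub_le {A : Type*} [NormedRing A] [NormedAlgebra ℂ A] {m : ℕ}
    (hm : 1 ≤ m) {e f : A} (he : IsNPotent (m + 1) e) {s d : ℝ} (hs : 1 ≤ s) (hes : ‖e‖ ≤ s)
    (hd : ∀ j, ‖f ^ j - e ^ j‖ ≤ s ^ j * d) :
    ‖nPotentIntertwiner (m + 1) e f - (m : ℂ) • (1 : A)‖ ≤ 3 * m * s ^ (2 * m) * d := by
  have hs0 : 0 ≤ s := zero_le_one.trans hs
  have hd0 : 0 ≤ d := by simpa using (norm_nonneg _).trans (hd 0)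
  have hmul : ∀ k j, ‖e ^ k * (f ^ j - e ^ j)‖ ≤ s ^ (k + j) * d := fun k j =>
    (norm_pow_mul_le_of_norm_le hs0 hes _ _).trans (by
      rw [pow_add, mul_assoc]; exact mul_le_mul_of_nonneg_left (hd j) (by positivity))
  have hpow : s ^ m * d ≤ s ^ (2 * m) * d :=
    mul_le_mul_of_nonneg_right (pow_le_pow_right₀ hs (by omega)) hd0
  rw [nPotentIntertwiner_sub hm he]
  have b1 : ‖((m : ℂ) + 1) • (e ^ m * (f ^ m - e ^ m))‖ ≤ (m + 1) * (s ^ (2 * m) * d) := by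
    rw [norm_smul, two_mul]
    have : ‖(m : ℂ) + 1‖ = m + 1 := by exact_mod_cast Complex.norm_natCast (m + 1)
    rw [this]
    exact mul_le_mul_of_nonneg_left (hmul m m) (by positivity)
  have b2 : ‖(m : ℂ) • (f ^ m - e ^ m)‖ ≤ m * (s ^ (2 * m) * d) := by
    rw [norm_smul, Complex.norm_natCast]
    exact mul_le_mul_of_nonneg_left ((hd m).trans hpow) (by positivity)
  have b3 : ‖∑ k ∈ Finset.Icc 1 (m - 1), e ^ k * (f ^ (m - k) - e ^ (m - k))‖
      ≤ (m - 1) * (s ^ (2 * m) * d) := by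
    refine (norm_sum_le_of_le (f := fun k => e ^ k * (f ^ (m - k) - e ^ (m - k))) _
      (n := fun _ => s ^ (2 * m) * d) fun k hk => ?_).trans ?_
    · have := Finset.mem_Icc.1 hk
      refine (hmul _ _).trans ?_
      rw [show k + (m - k) = m by omega]
      exact hpow
    · rw [Finset.sum_const, Nat.card_Icc, nsmul_eq_mul, Nat.add_sub_cancel, Nat.cast_sub hm,
        Nat.cast_one]
  refine (norm_add_le _ _).trans ?_
  have := norm_sub_le (((m : ℂ) + 1) • (e ^ m * (f ^ m - e ^ m))) ((m : ℂ) • (f ^ m - e ^ m))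
  linarith

/-! ### Circle integrals of the resolvent. -/

theorem smul_resolvent_add {B : Type*} [Ring B] [Algebra ℂ B] (x : B) (c : ℂ) {u : ℂ}
    (hu : u ≠ 0) :
    u • resolvent x (c + u) = Ring.inverse (1 - u⁻¹ • (x - algebraMap ℂ B c)) := by
  have h := spectrum.units_smul_resolvent_self (r := Units.mk0 u hu) (a := x - algebraMap ℂ B c)
  simp only [Units.smul_def, Units.val_mk0, Units.val_inv_eq_inv_val, resolvent, map_one] at h
  rw [← h, resolvent, map_add]
  congr 2
  abel

theorem isUnit_one_sub_smul_of_norm_lt {B : Type*} [NormedRing B] [NormedAlgebra ℂ B]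
    [CompleteSpace B] {a : B} {r : ℝ} (hr : 0 < r) (ha : ‖a‖ < r) {w : ℂ} (hw : ‖w‖ ≤ r⁻¹) :
    IsUnit (1 - w • a) := by
  refine isUnit_one_sub_of_norm_lt_one ?_
  rw [norm_smul]
  calc ‖w‖ * ‖a‖ ≤ r⁻¹ * ‖a‖ := mul_le_mul_of_nonneg_right hw (norm_nonneg _)
    _ < r⁻¹ * r := mul_lt_mul_of_pos_left ha (inv_pos.2 hr)
    _ = 1 := inv_mul_cancel₀ hr.ne'

theorem mem_resolventSet_of_le_norm_sub {B : Type*} [NormedRing B] [NormedAlgebra ℂ B]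
    [CompleteSpace B] {x : B} {c z : ℂ} {r : ℝ} (hr : 0 < r) (hx : ‖x - algebraMap ℂ B c‖ < r)
    (hz : r ≤ ‖z - c‖) : z ∈ resolventSet ℂ x := by
  have hu : z - c ≠ 0 := norm_pos_iff.1 (hr.trans_le hz)
  have h := isUnit_one_sub_smul_of_norm_lt hr hx (w := (z - c)⁻¹) (by
    rw [norm_inv]; exact inv_anti₀ hr hz)
  rw [spectrum.mem_resolventSet_iff]
  have e : algebraMap ℂ B z - x
      = Units.mk0 (z - c) hu • (1 - (z - c)⁻¹ • (x - algebraMap ℂ B c)) := by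
    rw [Units.smul_def, Units.val_mk0, smul_sub, smul_inv_smul₀ hu,
      ← Algebra.algebraMap_eq_smul_one, map_sub]
    abel
  rw [e]
  exact h.smul _

/-- Under `w = r/(z-c)` the function `(z-c) • resolvent x z` becomes `g`, holomorphic on the closed
unit disc with `g 0 = 1`; the mean value property gives the integral. -/
theorem circleIntegral_resolvent {B : Type*} [NormedRing B] [NormedAlgebra ℂ B] [CompleteSpace B]
    {x : B} {c : ℂ} {r : ℝ} (hr : 0 < r) (hx : ‖x - algebraMap ℂ B c‖ < r) :
    (∮ z in C(c, r), resolvent x z) = (2 * (Real.pi : ℂ) * Complex.I) • (1 : B) := by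
  set a := x - algebraMap ℂ B c
  let g : ℂ → B := fun w => Ring.inverse (1 - ((r : ℂ)⁻¹ * w) • a)
  have hr0 : (r : ℂ) ≠ 0 := Complex.ofReal_ne_zero.2 hr.ne'
  have hg : DiffContOnCl ℂ g (Metric.ball 0 |1|) := by
    refine DifferentiableOn.diffContOnCl fun w hw => ?_
    rw [abs_one] at hw
    have hw' : ‖w‖ ≤ 1 := by
      simpa using Metric.closure_ball_subset_closedBall hw
    have hu : IsUnit (1 - ((r : ℂ)⁻¹ * w) • a) := by
      refine isUnit_one_sub_smul_of_norm_lt hr hx ?_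
      rw [norm_mul, norm_inv, Complex.norm_real, Real.norm_of_nonneg hr.le]
      exact mul_le_of_le_one_right (inv_nonneg.2 hr.le) hw'
    have hd := differentiableAt_inverse (𝕜 := ℂ) hu
    refine (DifferentiableAt.comp (g := Ring.inverse)
      (f := fun w : ℂ => 1 - ((r : ℂ)⁻¹ * w) • a) w hd ?_).differentiableWithinAt
    fun_prop
  have hmean : (2 * Real.pi)⁻¹ • ∫ θ in (0 : ℝ)..2 * Real.pi, g (circleMap 0 1 θ)⁻¹ = 1 := by
    have h := hg.circleAverage
    -- Inversion maps the unit circle to itself and preserves averages.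
    rw [← Real.circleAverage_zero_one_congr_inv, Real.circleAverage_def] at h
    rw [h]
    simp [g]
  have hint : (∮ z in C(c, r), resolvent x z)
      = Complex.I • ∫ θ in (0 : ℝ)..2 * Real.pi, g (circleMap 0 1 θ)⁻¹ := by
    rw [circleIntegral, ← intervalIntegral.integral_smul]
    refine intervalIntegral.integral_congr fun θ _ => ?_
    have hu : circleMap 0 r θ ≠ 0 := circleMap_ne_center hr.ne'
    have h1 : circleMap c r θ = c + circleMap 0 r θ := by simp [circleMap]
    have h2 : (circleMap 0 r θ)⁻¹ = (r : ℂ)⁻¹ * (circleMap 0 1 θ)⁻¹ := by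
      simp [circleMap, mul_comm]
    simp only [g]
    rw [deriv_circleMap, mul_comm, mul_smul, h1, smul_resolvent_add _ _ hu, h2]
  rw [inv_smul_eq_iff₀ (by positivity)] at hmean
  rw [hint, hmean, ← Complex.coe_smul, smul_smul]
  congr 1
  push_cast
  ring

/-- From `(z-x)R = 1` one gets `R = z⁻¹ + z⁻¹ x R`, and `z⁻¹` integrates to `0` because `r < 1`
leaves `0` outside the circle. -/
theorem circleIntegral_inv_smul_resolvent {B : Type*} [NormedRing B] [NormedAlgebra ℂ B]
    [CompleteSpace B] {x : B} {r : ℝ} (hr : 0 < r) (hr1 : r < 1) (hx : ‖x - 1‖ < r) :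
    x * ∮ z in C(1, r), z⁻¹ • resolvent x z = (2 * (Real.pi : ℂ) * Complex.I) • (1 : B) := by
  have hx' : ‖x - algebraMap ℂ B 1‖ < r := by rwa [map_one]
  have hz0 : ∀ z ∈ Metric.closedBall (1 : ℂ) r, z ≠ 0 := by
    rintro z hz rfl
    rw [mem_closedBall_iff_norm, zero_sub, norm_neg, norm_one] at hz
    linarith
  have hres : ∀ z ∈ Metric.sphere (1 : ℂ) r, z ∈ resolventSet ℂ x := fun z hz =>
    mem_resolventSet_of_le_norm_sub hr hx' (mem_sphere_iff_norm.1 hz).ge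
  have hcr : ContinuousOn (resolvent x) (Metric.sphere (1 : ℂ) r) := fun z hz =>
    (spectrum.hasDerivAt_resolvent_const_left (hres z hz)).continuousAt.continuousWithinAt
  have hci : ContinuousOn (fun z : ℂ => z⁻¹) (Metric.closedBall (1 : ℂ) r) :=
    continuousOn_id.inv₀ hz0
  have hci' := hci.mono Metric.sphere_subset_closedBall
  have hinv : (∮ z in C(1, r), z⁻¹ • (1 : B)) = 0 := by
    rw [circleIntegral.integral_smul_const]
    rw [Complex.circleIntegral_eq_zero_of_differentiable_on_off_countable hr.le
      Set.countable_empty hci fun z hz => differentiableAt_inv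
        (hz0 z (Metric.ball_subset_closedBall hz.1)), zero_smul]
  have hpull : x * ∮ z in C(1, r), z⁻¹ • resolvent x z
      = ∮ z in C(1, r), x * (z⁻¹ • resolvent x z) := by
    have h := ((hci'.smul hcr).circleIntegrable hr.le).out
    simp only [circleIntegral]
    refine ((ContinuousLinearMap.mul ℂ B x).intervalIntegral_comp_comm h).symm.trans ?_
    simp
  rw [hpull, ← circleIntegral_resolvent hr hx', ← add_zero (∮ z in C(1, r), x * _), ← hinv,
    ← circleIntegral.integral_add]
  · refine circleIntegral.integral_congr hr.le fun z hz => ?_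
    have hz0' := hz0 z (Metric.sphere_subset_closedBall hz)
    have h : (algebraMap ℂ B z - x) * resolvent x z = 1 :=
      Ring.mul_inverse_cancel _ (hres z hz)
    rw [sub_mul, sub_eq_iff_eq_add', Algebra.algebraMap_eq_smul_one, smul_mul_assoc, one_mul] at h
    rw [mul_smul_comm, ← smul_add, ← h, inv_smul_smul₀ hz0']
  · exact ((continuousOn_const.mul (hci'.smul hcr))).circleIntegrable hr.le
  · exact (hci'.smul continuousOn_const).circleIntegrable hr.le

/-! ### Circles as contours, and `1 × 1` matrices. -/

/-- The circle with centre `c` and radius `r`, run through once anticlockwise. -/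
noncomputable def circleContour (c : ℂ) (r : ℝ) : Contour where
  size := 1
  curve _ t := circleMap c r (2 * Real.pi * t)
  contDiffOn_curve _ := ((contDiff_circleMap c r).comp (by fun_prop)).contDiffOn
  closed_curve _ := by simp [circleMap]

theorem circleContour_integral {E : Type*} [NormedAddCommGroup E] [NormedSpace ℂ E] (c : ℂ)
    (r : ℝ) (F : ℂ → E) : (circleContour c r).integral F = ∮ z in C(c, r), F z := by
  have hd : ∀ t : ℝ, deriv (fun t : ℝ => circleMap c r (2 * Real.pi * t)) t
      = (2 * Real.pi) • deriv (circleMap c r) (2 * Real.pi * t) := fun t => by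
    have h := (hasDerivAt_circleMap c r (2 * Real.pi * t)).scomp t
      ((hasDerivAt_id t).const_mul (2 * Real.pi))
    rw [mul_one] at h
    rw [deriv_circleMap]
    exact h.deriv
  have h := intervalIntegral.smul_integral_comp_mul_left (a := 0) (b := 1)
    (fun θ => deriv (circleMap c r) θ • F (circleMap c r θ)) (2 * Real.pi)
  rw [mul_zero, mul_one] at h
  rw [circleIntegral, ← h, ← intervalIntegral.integral_smul]
  refine (Fin.sum_univ_one _).trans ?_
  simp only [circleContour, hd, smul_assoc]

theorem circleContour_surrounds {K : Set ℂ} {c : ℂ} {r R : ℝ} (hr : 0 < r) (hrR : r < R)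
    (hK : K ⊆ Metric.ball c r) : (circleContour c r).Surrounds K (Metric.ball c R) := by
  refine ⟨?_, fun w hw => ?_, fun w hw => ?_⟩
  · refine Set.iUnion_subset fun i => ?_
    rintro _ ⟨t, -, rfl⟩
    have h : circleMap c r (2 * Real.pi * t) ∈ Metric.sphere c r :=
      circleMap_mem_sphere c hr.le _
    exact ⟨Metric.sphere_subset_ball hrR h,
      fun hk => (Metric.mem_ball.1 (hK hk)).ne (Metric.mem_sphere.1 h)⟩
  · rw [Contour.windingNumber, circleContour_integral,
      circleIntegral.integral_sub_inv_of_mem_ball (hK hw), inv_mul_cancel₀ Complex.two_pi_I_ne_zero]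
  · have hne : ∀ z ∈ Metric.closedBall c r, z - w ≠ 0 := fun z hz h => by
      rw [sub_eq_zero] at h
      exact hw (h ▸ Metric.closedBall_subset_ball hrR hz)
    have h0 : (∮ z in C(c, r), (z - w)⁻¹) = 0 :=
      Complex.circleIntegral_eq_zero_of_differentiable_on_off_countable hr.le Set.countable_empty
        ((continuousOn_id.sub continuousOn_const).inv₀ hne) fun z hz =>
        (differentiableAt_id.sub_const w).inv (hne z (Metric.ball_subset_closedBall hz.1))
    rw [Contour.windingNumber, circleContour_integral, h0, mul_zero]

/-- The `1 × 1` matrices over an algebra are the algebra itself. -/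
def matrixFinOneAlgEquiv (B : Type*) [Ring B] [Algebra ℂ B] :
    Matrix (Fin 1) (Fin 1) B ≃ₐ[ℂ] B where
  toFun X := X 0 0
  invFun b := Matrix.of fun _ _ => b
  left_inv X := by
    ext i j
    rw [Subsingleton.elim i 0, Subsingleton.elim j 0]
    rfl
  right_inv _ := rfl
  map_mul' X Y := by simp [Matrix.mul_apply]
  map_add' _ _ := rfl
  commutes' _ := by simp [Matrix.algebraMap_matrix_apply]

theorem resolvent_matrix_fin_one_apply {B : Type*} [Ring B] [Algebra ℂ B]
    (X : Matrix (Fin 1) (Fin 1) B) {z : ℂ} (hz : z ∈ resolventSet ℂ (X 0 0)) :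
    resolvent X z 0 0 = resolvent (X 0 0) z := by
  let φ := matrixFinOneAlgEquiv B
  have hφ : φ (algebraMap ℂ _ z - X) = algebraMap ℂ B z - X 0 0 := by
    rw [map_sub, AlgEquiv.commutes]
    rfl
  have hX : IsUnit (algebraMap ℂ _ z - X) := by
    refine (MulEquiv.isUnit_map φ).1 ?_
    rw [hφ]
    exact hz
  obtain ⟨u, hu⟩ := hX
  rw [resolvent, resolvent, ← hφ, ← hu, Ring.inverse_unit]
  exact (Ring.inverse_unit (Units.map (φ : Matrix (Fin 1) (Fin 1) B →* B) u)).symm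

/-! ### Invertibility near `1` in a local Banach algebra. -/

theorem isUnit_of_norm_sub_one_lt {A : Type*} [NormedRing A] [NormedAlgebra ℂ A]
    [IsLocalBanachAlgebra A] {x : A} (hx : ‖x - 1‖ < 1) : IsUnit x := by
  set b : UniformSpace.Completion A := (x : UniformSpace.Completion A) with hb
  obtain ⟨r, hxr, hr1⟩ := exists_between hx
  have hr : 0 < r := (norm_nonneg _).trans_lt hxr
  have hbr : ‖b - 1‖ < r := by
    rw [hb, ← UniformSpace.Completion.coe_one, ← UniformSpace.Completion.coe_sub,
      UniformSpace.Completion.norm_coe]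
    exact hxr
  let X : Matrix (Fin 1) (Fin 1) A := Matrix.of fun _ _ => x
  let Xhat : Matrix (Fin 1) (Fin 1) (UniformSpace.Completion A) := Matrix.of fun _ _ => b
  have hspec : spectrum ℂ Xhat = spectrum ℂ b :=
    (AlgEquiv.spectrum_eq (matrixFinOneAlgEquiv _) Xhat).symm
  have hball : ∀ s, ‖b - 1‖ < s → spectrum ℂ Xhat ⊆ Metric.ball 1 s := by
    intro s hs z hz
    rw [hspec] at hz
    by_contra hzs
    rw [mem_ball_iff_norm, not_lt] at hzs
    exact hz (mem_resolventSet_of_le_norm_sub ((norm_nonneg _).trans_lt hs)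
      (by rwa [map_one]) hzs)
  obtain ⟨y, hy⟩ := IsLocalBanachAlgebra.closed_functionalCalculus 1 X Xhat rfl
    (Metric.ball 1 1) (fun z => z⁻¹) Metric.isOpen_ball (hball 1 (hbr.trans hr1))
    (fun z hz => (differentiableAt_inv (by
      rintro rfl
      simp at hz)).differentiableWithinAt)
    (circleContour 1 r) (circleContour_surrounds hr hr1 (hball r hbr))
  have hy0 : ((y 0 0 : A) : UniformSpace.Completion A)
      = (2 * (Real.pi : ℂ) * Complex.I)⁻¹ • ∮ z in C(1, r), z⁻¹ • resolvent b z := by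
    have h := congrFun (congrFun hy 0) 0
    simp only [Matrix.map_apply, holomorphicFunctionalCalculus, Matrix.of_apply,
      circleContour_integral] at h
    rw [h]
    congr 1
    refine circleIntegral.integral_congr hr.le fun z hz => ?_
    have := resolvent_matrix_fin_one_apply Xhat (z := z)
      (mem_resolventSet_of_le_norm_sub (c := 1) hr (by rwa [map_one])
        (mem_sphere_iff_norm.1 hz).ge)
    simp only [this]
    rfl
  have hright : x * y 0 0 = 1 := by
    apply UniformSpace.Completion.coe_injective A
    rw [UniformSpace.Completion.coe_mul, hy0, mul_smul_comm,
      circleIntegral_inv_smul_resolvent hr hr1 hbr, inv_smul_smul₀ Complex.two_pi_I_ne_zero,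
      UniformSpace.Completion.coe_one]
  have hunit : IsUnit b := by
    have := isUnit_one_sub_of_norm_lt_one (x := 1 - b) (by
      rw [norm_sub_rev]; exact hbr.trans hr1)
    rwa [sub_sub_cancel] at this
  -- In the completion `b` is a unit, so its right inverse is two-sided; injectivity of the
  -- embedding returns this to `A`.
  have hleft : y 0 0 * x = 1 := by
    apply UniformSpace.Completion.coe_injective A
    have h := congrArg (fun a : A => (a : UniformSpace.Completion A)) hright
    simp only [UniformSpace.Completion.coe_mul, UniformSpace.Completion.coe_one] at h ⊢
    obtain ⟨u, hu⟩ := hunit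
    rw [← hb, ← hu] at h ⊢
    rw [← Units.mul_eq_one_iff_inv_eq.1 h, u.inv_mul]
  exact ⟨⟨x, y 0 0, hright, hleft⟩, rfl⟩

/-! ### The similarity. -/

theorem norm_inv_smul_nPotentIntertwiner_sub_one_lt {A : Type*} [NormedRing A] [NormedAlgebra ℂ A]
    {m : ℕ} (hm : 1 ≤ m) {e f : A} (he : IsNPotent (m + 1) e) {s d : ℝ} (hs : 1 ≤ s)
    (hes : ‖e‖ ≤ s) (hd : ∀ j, ‖f ^ j - e ^ j‖ ≤ s ^ j * d) (hlt : 3 * s ^ (2 * m) * d < 1) :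
    ‖(m : ℂ)⁻¹ • nPotentIntertwiner (m + 1) e f - 1‖ < 1 := by
  have hm0 : (m : ℂ) ≠ 0 := Nat.cast_ne_zero.2 (by omega)
  have hm1 : (0 : ℝ) < m := Nat.cast_pos.2 hm
  have h : (m : ℂ)⁻¹ • nPotentIntertwiner (m + 1) e f - 1
      = (m : ℂ)⁻¹ • (nPotentIntertwiner (m + 1) e f - (m : ℂ) • (1 : A)) := by
    rw [smul_sub, inv_smul_smul₀ hm0]
  rw [h, norm_smul, norm_inv, Complex.norm_natCast, inv_mul_lt_iff₀ hm1]
  refine (norm_nPotentIntertwiner_sub_le hm he hs hes hd).trans_lt ?_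
  calc 3 * m * s ^ (2 * m) * d = m * (3 * s ^ (2 * m) * d) := by ring
    _ < m * 1 := mul_lt_mul_of_pos_left hlt hm1

theorem mainTheorem7 {A : Type*} [NormedRing A] [NormedAlgebra ℂ A] [IsLocalBanachAlgebra A]
    (n : ℕ) (hn : 2 ≤ n) (e f : A) (he : IsNPotent n e) (hf : IsNPotent n f)
    (M : ℝ) (hM : M = (1 + ‖e‖) ^ (2 * n))
    (hef : ‖e - f‖ < 2 * ((n : ℝ) - 1) / (((n : ℝ) ^ 2 + n + 2) * M)) :
    1 ≤ M ∧ 2 * ((n : ℝ) - 1) / (((n : ℝ) ^ 2 + n + 2) * M) < 1 ∧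
    (∃ z : Aˣ, (z : A) = ((n : ℂ) - 1)⁻¹ • nPotentIntertwiner n f e ∧
      ‖(z : A) - 1‖ < 1 ∧ (z : A) * e * ((z⁻¹ : Aˣ) : A) = f) ∧
    (∃ w : Aˣ, (w : A) = ((n : ℂ) - 1)⁻¹ • nPotentIntertwiner n e f ∧
      ‖(w : A) - 1‖ < 1 ∧ ((w⁻¹ : Aˣ) : A) * e * (w : A) = f) := by
  have hs : 1 ≤ 1 + ‖e‖ := le_add_of_nonneg_right (norm_nonneg e)
  have hM1 : 1 ≤ M := hM ▸ one_le_pow₀ hs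
  have hn' : (2 : ℝ) ≤ n := by exact_mod_cast hn
  have hpos : 0 < ((n : ℝ) ^ 2 + n + 2) * M := by positivity
  have hbound : 2 * ((n : ℝ) - 1) / (((n : ℝ) ^ 2 + n + 2) * M) < 1 := by
    rw [div_lt_one hpos]
    nlinarith
  have hd1 := hef.trans hbound
  have hfs : ‖f‖ ≤ 1 + ‖e‖ := by
    have := norm_le_norm_add_norm_sub e f
    linarith
  have hfe : ∀ j, ‖f ^ j - e ^ j‖ ≤ (1 + ‖e‖) ^ j * ‖e - f‖ := fun j =>
    norm_sub_rev e f ▸ norm_pow_sub_pow_le hfs j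
  have hef' : ∀ j, ‖e ^ j - f ^ j‖ ≤ (1 + ‖e‖) ^ j * ‖e - f‖ := fun j =>
    norm_sub_rev (e ^ j) (f ^ j) ▸ hfe j
  have hlt : 3 * (1 + ‖e‖) ^ (2 * (n - 1)) * ‖e - f‖ < 1 := by
    have hpow : (1 + ‖e‖) ^ (2 * (n - 1)) ≤ M := hM ▸ pow_le_pow_right₀ hs (by omega)
    rw [lt_div_iff₀ hpos] at hef
    have h1 : (1 + ‖e‖) ^ (2 * (n - 1)) * ‖e - f‖ ≤ M * ‖e - f‖ :=
      mul_le_mul_of_nonneg_right hpow (norm_nonneg _)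
    have h2 : 0 ≤ M * ‖e - f‖ := by positivity
    by_contra! hge
    have h3 : 1 ≤ 3 * (M * ‖e - f‖) := by linarith
    -- The contradiction needs `6(n-1) ≤ n²+n+2`, that is `(n - 5/2)² + 7/4 ≥ 0`.
    nlinarith [sq_nonneg ((n : ℝ) - 5 / 2)]
  obtain ⟨m, rfl⟩ := Nat.exists_eq_add_of_le' (one_le_two.trans hn)
  have hm : 1 ≤ m := by omega
  rw [Nat.add_sub_cancel] at hlt
  have hcast : ((m + 1 : ℕ) : ℂ) - 1 = m := by push_cast; ring
  rw [hcast]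
  refine ⟨hM1, hbound, ?_, ?_⟩
  · have hz := norm_inv_smul_nPotentIntertwiner_sub_one_lt hm hf hs hfs hef' hlt
    obtain ⟨z, hz'⟩ := isUnit_of_norm_sub_one_lt hz
    refine ⟨z, hz', hz' ▸ hz, ?_⟩
    rw [Units.mul_inv_eq_iff_eq_mul, hz', smul_mul_assoc, mul_smul_comm,
      mul_nPotentIntertwiner hn hf he]
  · have hw := norm_inv_smul_nPotentIntertwiner_sub_one_lt hm he hs
      (le_add_of_nonneg_left zero_le_one) hfe hlt
    obtain ⟨w, hw'⟩ := isUnit_of_norm_sub_one_lt hw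
    refine ⟨w, hw', hw' ▸ hw, ?_⟩
    rw [mul_assoc, Units.inv_mul_eq_iff_eq_mul, hw', smul_mul_assoc, mul_smul_comm,
      mul_nPotentIntertwiner hn he hf]
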